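/- Let $p$ be a prime and let $G$ be a finite group of order $p^6$ whose nilpotence class is at least $3$. For an irreducible complex character $\chi$ of $G$, let $\ker\chi=\{g\in G:\chi(g)=\chi(1)\}$ and let $\operatorname{cod}(\chi)=|G:\ker\chi|/\chi(1)$ be its codegree; let $\operatorname{cod}(G)=\{\operatorname{cod}(\chi):\chi\in\operatorname{Irr}(G)\}$. Then $p^2\in\operatorname{cod}(G)$. -/

import Mathlib

/-!
A linear character of order `p ^ 2` has codegree `p ^ 2`, so we may assume that `g ^ p ∈ G'` for
every `g`. Otherwise we look for a normal subgroup `M` such that `G ⧸ M` has commutator subgroup of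
order `p`, centre of index `p ^ 2` and centre of exponent `p`. An irreducible representation of
`G ⧸ M` which is nontrivial on the commutator subgroup has a character vanishing off the centre.
Hence its degree is `p`, and as the centre acts by a scalar of order `p`, its kernel has index `p`
in the centre. The codegree is therefore `p ^ 3 / p`.

Write `Γ = [G', G]`, which is nontrivial, and let `M` have index `p` in `G'` and contain `Γ`.

* If `|G : G'| ≤ p ^ 2`, any such `M` works: the index of the centre of `G ⧸ M` is a square, so the
  centre is the commutator subgroup.
* Otherwise it suffices that `M` contains `[U, U]` for some `U` of index `p`, which bounds the index
  of the centre, and that `z ^ p ∈ M` whenever `[z, G] ≤ M`. If `|Γ| = p` and `U` centralizes `G'`,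
  take `M = Z(G) ∩ G'`. If `|Γ| = p` and `[U, U] ≤ Γ` but `U` does not centralize `G'`, let `M`
  contain the centralizer of `U` in `G'`.
* If `|G' : Γ| = p`, we may divide by a subgroup of index `p` in `Γ` to get `|Γ| = p`, and the
  centralizer of any noncentral element of `G'` is such a `U`.
* The remaining case is `|G'| = p ^ 3` and `|Γ| = p`. Then `G ⧸ Γ` has class two and order `p ^ 5`,
  and its commutator subgroup has order `p ^ 2`; such a group has an abelian subgroup of index `p`,
  whose preimage is a `U` with `[U, U] ≤ Γ`.
-/

namespace Codegree

/-- An endomorphism of finite order of a finite-dimensional complex space whose trace is the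
dimension is the identity. -/
theorem eq_one_of_trace_eq_finrank {V : Type*} [AddCommGroup V] [Module ℂ V]
    [FiniteDimensional ℂ V] (f : Module.End ℂ V) {n : ℕ} (hn : n ≠ 0) (hf : f ^ n = 1)
    (ht : LinearMap.trace ℂ V f = Module.finrank ℂ V) : f = 1 := by
  have hroot : ∀ μ ∈ f.charpoly.roots, ‖μ‖ = 1 := by
    intro μ hμ
    have hev : f.HasEigenvalue μ := by
      rw [Module.End.hasEigenvalue_iff_isRoot_charpoly]
      exact Polynomial.isRoot_of_mem_roots hμ
    obtain ⟨v, hv⟩ := hev.exists_hasEigenvector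
    have h1 := hv.pow_apply n
    rw [hf, Module.End.one_apply] at h1
    have h2 : (μ ^ n - 1) • v = 0 := by rw [sub_smul, ← h1, one_smul, sub_self]
    have h3 : μ ^ n = 1 := by
      rcases smul_eq_zero.1 h2 with h | h
      · exact sub_eq_zero.1 h
      · exact absurd h hv.2
    exact Complex.norm_eq_one_of_pow_eq_one h3 hn
  have hsplit : f.charpoly.Splits := IsAlgClosed.splits _
  have hcard : Multiset.card f.charpoly.roots = Module.finrank ℂ V := by
    rw [IsAlgClosed.card_roots_eq_natDegree, LinearMap.charpoly_natDegree]
  have hsum : f.charpoly.roots.sum = Multiset.card f.charpoly.roots := by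
    rw [hcard, ← ht, Module.End.trace_eq_sum_roots_charpoly_of_splits hsplit]
  have hone : ∀ μ ∈ f.charpoly.roots, μ = 1 := by
    have hz : (f.charpoly.roots.map fun μ => 1 - μ.re).sum = 0 := by
      have h1 : ∀ s : Multiset ℂ,
          (s.map fun μ => 1 - μ.re).sum = (Multiset.card s : ℝ) - s.sum.re := by
        intro s
        induction s using Multiset.induction_on with
        | empty => simp
        | cons a s ih => simp [ih]; ring
      rw [h1, hsum]
      simp
    intro μ hμ
    have hre : 1 - μ.re = 0 := by
      refine Multiset.all_zero_of_le_zero_le_of_sum_eq_zero ?_ hz _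
        (Multiset.mem_map_of_mem (fun μ : ℂ => 1 - μ.re) hμ)
      intro x hx
      obtain ⟨ν, hν, rfl⟩ := Multiset.mem_map.1 hx
      have := Complex.re_le_norm ν
      rw [hroot ν hν] at this
      linarith
    have hn1 := hroot μ hμ
    have h4 : μ.re * μ.re + μ.im * μ.im = 1 := by
      rw [← Complex.normSq_apply, Complex.normSq_eq_norm_sq, hn1, one_pow]
    have hre1 : μ.re = 1 := by linarith
    rw [hre1] at h4
    have him : μ.im = 0 := mul_self_eq_zero.1 (by linarith)
    exact Complex.ext hre1 him
  have hchar : f.charpoly = (Polynomial.X - Polynomial.C 1) ^ Module.finrank ℂ V := by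
    have h := hsplit.eq_prod_roots_of_monic f.charpoly_monic
    rw [Multiset.eq_replicate_of_mem hone, hcard] at h
    simpa using h
  have hdvd1 : minpoly ℂ f ∣ Polynomial.X ^ n - 1 := by
    apply minpoly.dvd
    simp [hf]
  have hsq : Squarefree (minpoly ℂ f) :=
    (Polynomial.X_pow_sub_one_separable_iff.2 (Nat.cast_ne_zero.2 hn)).squarefree.squarefree_of_dvd
      hdvd1
  have hdvd2 : minpoly ℂ f ∣ (Polynomial.X - Polynomial.C 1) ^ (Module.finrank ℂ V + 1) := by
    rw [pow_succ, ← hchar]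
    exact (LinearMap.minpoly_dvd_charpoly f).mul_right _
  obtain ⟨q, hq⟩ := (hsq.dvd_pow_iff_dvd (Nat.succ_ne_zero _)).1 hdvd2
  have h5 := congrArg (Polynomial.aeval f) hq
  rw [map_mul, minpoly.aeval, zero_mul] at h5
  simpa [sub_eq_zero] using h5

/-- `Irr G`: the set of irreducible complex characters of `G`. -/
def Irr (G : Type*) [Group G] : Set (G → ℂ) :=
  {χ | ∃ (V : Type) (_ : AddCommGroup V) (_ : Module ℂ V) (_ : FiniteDimensional ℂ V)
      (ρ : Representation ℂ G V), ρ.IsIrreducible ∧ χ = ρ.character}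

variable {G : Type*} [Group G]

theorem character_eq_iff_mem_ker [Finite G] {V : Type*} [AddCommGroup V] [Module ℂ V]
    [FiniteDimensional ℂ V] (ρ : Representation ℂ G V) (g : G) :
    ρ.character g = ρ.character 1 ↔ g ∈ MonoidHom.ker ρ := by
  rw [MonoidHom.mem_ker]
  constructor
  · intro h
    refine eq_one_of_trace_eq_finrank (ρ g) (n := Nat.card G) Nat.card_pos.ne' ?_ ?_
    · rw [← map_pow, pow_card_eq_one', map_one]
    · rwa [Representation.char_one] at h
  · intro h
    simp only [Representation.character, h, map_one]

theorem exists_ker_eq [Finite G] (χ : Irr G) :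
    ∃ K : Subgroup G, ∀ g, g ∈ K ↔ χ.1 g = χ.1 1 := by
  obtain ⟨χ, V, _, _, _, ρ, -, rfl⟩ := χ
  exact ⟨MonoidHom.ker ρ, fun g => (character_eq_iff_mem_ker ρ g).symm⟩

/-- The kernel `{g | χ g = χ 1}` of an irreducible character of a finite group. -/
def ker [Finite G] (χ : Irr G) : Subgroup G where
  carrier := {g | χ.1 g = χ.1 1}
  one_mem' := rfl
  mul_mem' := by
    obtain ⟨K, hK⟩ := exists_ker_eq χ
    intro a b ha hb
    exact (hK _).1 (K.mul_mem ((hK _).2 ha) ((hK _).2 hb))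
  inv_mem' := by
    obtain ⟨K, hK⟩ := exists_ker_eq χ
    intro a ha
    exact (hK _).1 (K.inv_mem ((hK _).2 ha))

/-- The codegree `|G : ker χ| / χ(1)`. The degree `χ(1)` is never zero, so the quotient is
the genuine one. -/
noncomputable def codegree [Finite G] (χ : Irr G) : ℂ :=
  ((ker χ).index : ℂ) / χ.1 1

/-- `cod(G)`: the set of codegrees of the irreducible characters of `G`. -/
def cod (G : Type*) [Group G] [Finite G] : Set ℂ :=
  Set.range (codegree : Irr G → ℂ)

end Codegree

namespace Codegree

open scoped MonoidAlgebra commutatorElement IsMulCommutative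

section Representations

variable {k G V : Type*} [Field k] [Group G] [AddCommGroup V] [Module k V]
  {ρ : Representation k G V}

theorem isIrreducible_iff_forall_submodule :
    ρ.IsIrreducible ↔ Nontrivial V ∧
      ∀ W : Submodule k V, (∀ g, ∀ v ∈ W, ρ g v ∈ W) → W = ⊥ ∨ W = ⊤ := by
  rw [Representation.IsIrreducible, isSimpleOrder_iff]
  refine and_congr ⟨fun h => ?_, fun _ => ?_⟩ ⟨fun h W hW => ?_, fun h W => ?_⟩
  · by_contra hV
    rw [not_nontrivial_iff_subsingleton] at hV
    exact not_subsingleton (Subrepresentation ρ)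
      ⟨fun _ _ => Subrepresentation.toSubmodule_injective (Subsingleton.elim _ _)⟩
  · exact ⟨⊥, ⊤, fun h => bot_ne_top (congrArg Subrepresentation.toSubmodule h)⟩
  · exact (h ⟨W, fun g v => hW g v⟩).imp (congrArg Subrepresentation.toSubmodule)
      (congrArg Subrepresentation.toSubmodule)
  · exact (h W.toSubmodule fun g _ hv => W.apply_mem_toSubmodule g hv).imp
      (fun h => Subrepresentation.toSubmodule_injective h)
      (fun h => Subrepresentation.toSubmodule_injective h)

theorem isIrreducible_of_finrank_eq_one (h : Module.finrank k V = 1) : ρ.IsIrreducible := by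
  have hV : IsSimpleModule k V := isSimpleModule_iff_finrank_eq_one.2 h
  exact isIrreducible_iff_forall_submodule.2
    ⟨IsSimpleModule.nontrivial k V, fun W _ => eq_bot_or_eq_top W⟩

theorem isIrreducible_comp {H : Type*} [Group H] (hρ : ρ.IsIrreducible) {f : H →* G}
    (hf : Function.Surjective f) :
    Representation.IsIrreducible (ρ.comp f : Representation k H V) := by
  rw [isIrreducible_iff_forall_submodule] at hρ ⊢
  exact ⟨hρ.1, fun W hW => hρ.2 W (hf.forall.2 hW)⟩

theorem isIrreducible_conj {W : Type*} [AddCommGroup W] [Module k W] (hρ : ρ.IsIrreducible)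
    (e : V ≃ₗ[k] W) :
    Representation.IsIrreducible
      ((e.conjRingEquiv.toMonoidHom).comp ρ : Representation k G W) := by
  rw [isIrreducible_iff_forall_submodule] at hρ ⊢
  refine ⟨e.symm.toEquiv.nontrivial_congr.2 hρ.1, fun U hU => ?_⟩
  have h := hρ.2 (U.comap e.toLinearMap) fun g v hv => by
    simpa using hU g (e v) hv
  have hinj := Submodule.comap_injective_of_surjective (f := e.toLinearMap) e.surjective
  refine h.imp (fun h => hinj ?_) (fun h => hinj ?_)
  · rw [h, Submodule.comap_bot, LinearEquiv.ker]
  · rw [h, Submodule.comap_top]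

theorem isIrreducible_ofModule' {M : Type*} [AddCommGroup M] [Module k M] [Module k[G] M]
    [IsScalarTower k k[G] M] [IsSimpleModule k[G] M] :
    (Representation.ofModule' (k := k) (G := G) M).IsIrreducible := by
  refine isIrreducible_iff_forall_submodule.2 ⟨IsSimpleModule.nontrivial k[G] M, fun W hW => ?_⟩
  let W' : Submodule k[G] M := MonoidAlgebra.submoduleOfSMulMem W fun g v hv => by
    simpa [Representation.ofModule'] using hW g v hv
  refine (eq_bot_or_eq_top W').imp (fun h => ?_) (fun h => ?_) <;>
  exact SetLike.coe_injective (congrArg (fun U : Submodule k[G] M => (U : Set M)) h)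

theorem exists_isIrreducible_apply_ne_one [CharZero k] [Finite G] {c : G} (hc : c ≠ 1) :
    ∃ (n : ℕ) (σ : Representation k G (Fin n → k)), σ.IsIrreducible ∧ σ c ≠ 1 := by
  by_contra! H
  have hfix : ∀ x ∈ sSup {W : Submodule k[G] k[G] | IsSimpleModule k[G] W},
      MonoidAlgebra.of k G c * x = x := by
    intro x hx
    rw [sSup_eq_iSup'] at hx
    induction hx using Submodule.iSup_induction' with
    | mem W x hx =>
      have : IsSimpleModule k[G] W.1 := W.2
      have : FiniteDimensional k W.1 :=
        FiniteDimensional.finiteDimensional_submodule (W.1.restrictScalars k)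
      let e := (Module.finBasis k W.1).equivFun
      have hc1 : Representation.ofModule' (k := k) (G := G) W.1 c = 1 :=
        e.conjRingEquiv.injective
          ((H _ _ (isIrreducible_conj isIrreducible_ofModule' e)).trans (map_one _).symm)
      simpa [Representation.ofModule', Subtype.ext_iff] using LinearMap.congr_fun hc1 ⟨x, hx⟩
    | zero => exact mul_zero _
    | add x y _ _ hx hy => rw [mul_add, hx, hy]
  have : NeZero (Nat.card G : k) := ⟨Nat.cast_ne_zero.2 Nat.card_pos.ne'⟩
  have h1 := hfix 1 (by rw [IsSemisimpleModule.sSup_simples_eq_top]; trivial)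
  rw [mul_one, ← map_one (MonoidAlgebra.of k G)] at h1
  exact hc (MonoidAlgebra.of_injective h1)

variable [IsAlgClosed k] [FiniteDimensional k V]

theorem exists_eq_smul_one_of_commute (hρ : ρ.IsIrreducible) (T : Module.End k V)
    (hT : ∀ g, Commute T (ρ g)) : ∃ a : k, T = a • 1 := by
  obtain ⟨a, ha⟩ := hρ.algebraMap_intertwiningMap_bijective_of_isAlgClosed.2
    ⟨T, fun g => hT g⟩
  exact ⟨a, congrArg Representation.IntertwiningMap.toLinearMap ha.symm⟩

theorem exists_centralCharacter (hρ : ρ.IsIrreducible) :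
    ∃ ω : Subgroup.center G →* k, ∀ z : Subgroup.center G, ρ z = ω z • 1 := by
  have h (z : Subgroup.center G) : ∃ a : k, ρ z = a • 1 :=
    exists_eq_smul_one_of_commute hρ (ρ z) fun g =>
      Commute.map (Subgroup.mem_center_iff.1 z.2 g).symm ρ
  choose ω hω using h
  have := (isIrreducible_iff_forall_submodule.1 hρ).1
  have hinj : Function.Injective (fun a : k => a • (1 : Module.End k V)) :=
    smul_left_injective k one_ne_zero
  refine ⟨⟨⟨ω, hinj ?_⟩, fun x y => hinj ?_⟩, hω⟩
  · simp [← hω]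
  · simp only [← hω, Subgroup.coe_mul, map_mul, mul_smul]
    rw [hω x, hω y, smul_mul_assoc, one_mul]

/-- As `g` is conjugate to `⁅h, g⁆ * g`, its character value is multiplied by the scalar
`ρ ⁅h, g⁆ ≠ 1`. -/
theorem character_eq_zero_of_apply_commutatorElement_ne_one (hρ : ρ.IsIrreducible) {g h : G}
    (hgh : ⁅h, g⁆ ∈ Subgroup.center G) (hne : ρ ⁅h, g⁆ ≠ 1) : ρ.character g = 0 := by
  obtain ⟨ω, hω⟩ := exists_centralCharacter hρ
  have hconj := ρ.char_conj g h
  have hmul : h * g * h⁻¹ = ⁅h, g⁆ * g := by rw [commutatorElement_def]; group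
  rw [hmul, Representation.character, map_mul, hω ⟨_, hgh⟩, smul_mul_assoc, one_mul, map_smul,
    smul_eq_mul] at hconj
  by_contra h0
  apply hne
  rw [hω ⟨_, hgh⟩, mul_right_cancel₀ h0 (hconj.trans (one_mul _).symm), one_smul]

theorem character_mul_character_inv_of_mem_center (hρ : ρ.IsIrreducible) {z : G}
    (hz : z ∈ Subgroup.center G) :
    ρ.character z * ρ.character z⁻¹ = (Module.finrank k V : k) ^ 2 := by
  obtain ⟨ω, hω⟩ := exists_centralCharacter hρ
  have hchar (z : Subgroup.center G) : ρ.character z = ω z * Module.finrank k V := by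
    rw [Representation.character, hω, map_smul, LinearMap.trace_one, smul_eq_mul]
  have hinv : ω ⟨z, hz⟩ * ω ⟨z, hz⟩⁻¹ = 1 := by rw [← map_mul, mul_inv_cancel, map_one]
  have h1 := hchar ⟨z, hz⟩
  have h2 := hchar ⟨z, hz⟩⁻¹
  rw [InvMemClass.coe_inv] at h2
  rw [h1, h2]
  linear_combination (Module.finrank k V : k) ^ 2 * hinv

theorem finrank_sq_eq_index_center [CharZero k] [Finite G] (hρ : ρ.IsIrreducible)
    (hoff : ∀ g ∉ Subgroup.center G, ρ.character g = 0) :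
    Module.finrank k V ^ 2 = (Subgroup.center G).index := by
  classical
  have := Fintype.ofFinite G
  have hG : (Nat.card G : k) ≠ 0 := Nat.cast_ne_zero.2 Nat.card_pos.ne'
  have := invertibleOfNonzero hG
  have hsum : ∑ g, ρ.character g * ρ.character g⁻¹ = Nat.card G := by
    have h := Representation.char_orthonormal ρ ρ
    rwa [if_pos ⟨Representation.Equiv.refl ρ⟩, inv_mul_eq_iff_eq_mul₀ hG, mul_one] at h
  have hsum' : ∑ g, ρ.character g * ρ.character g⁻¹ =
      Nat.card (Subgroup.center G) * (Module.finrank k V : k) ^ 2 := by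
    have hval (g : G) : ρ.character g * ρ.character g⁻¹ =
        if g ∈ Subgroup.center G then (Module.finrank k V : k) ^ 2 else 0 := by
      split_ifs with hg
      · exact character_mul_character_inv_of_mem_center hρ hg
      · rw [hoff g hg, zero_mul]
    simp only [hval, ← Finset.sum_filter, Finset.sum_const, nsmul_eq_mul,
      Nat.card_eq_fintype_card, Fintype.card_subtype]
  refine Nat.eq_of_mul_eq_mul_left (Nat.card_pos (α := Subgroup.center G)) ?_
  rw [Subgroup.card_mul_index]
  exact_mod_cast hsum'.symm.trans hsum

theorem finrank_sq_eq_index_center_of_disjoint_ker [CharZero k] [Finite G]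
    (hρ : ρ.IsIrreducible) (hG : commutator G ≤ Subgroup.center G)
    (hker : Disjoint (MonoidHom.ker ρ) (commutator G)) :
    Module.finrank k V ^ 2 = (Subgroup.center G).index := by
  refine finrank_sq_eq_index_center hρ fun g hg => ?_
  simp only [Subgroup.mem_center_iff, not_forall] at hg
  obtain ⟨h, hgh⟩ := hg
  have hmem : ⁅h, g⁆ ∈ commutator G :=
    Subgroup.commutator_mem_commutator (Subgroup.mem_top h) (Subgroup.mem_top g)
  refine character_eq_zero_of_apply_commutatorElement_ne_one hρ (hG hmem) fun h1 => hgh ?_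
  exact commutatorElement_eq_one_iff_mul_comm.1 (Subgroup.disjoint_def.1 hker h1 hmem)

theorem relIndex_ker_center_dvd [CharZero k] (hρ : ρ.IsIrreducible) {n : ℕ} [NeZero n]
    (hn : ∀ z ∈ Subgroup.center G, z ^ n = 1) :
    (MonoidHom.ker ρ).relIndex (Subgroup.center G) ∣ n := by
  obtain ⟨ω, hω⟩ := exists_centralCharacter hρ
  have := (isIrreducible_iff_forall_submodule.1 hρ).1
  have hker : (MonoidHom.ker ρ).subgroupOf (Subgroup.center G) = ω.toHomUnits.ker := by
    ext z
    have hinj := smul_left_injective k (one_ne_zero (α := Module.End k V))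
    rw [Subgroup.mem_subgroupOf, MonoidHom.mem_ker, MonoidHom.mem_ker, hω, Units.ext_iff,
      MonoidHom.coe_toHomUnits, Units.val_one, ← hinj.eq_iff, one_smul]
  have hrange : ω.toHomUnits.range ≤ rootsOfUnity n k := by
    rintro _ ⟨z, rfl⟩
    rw [mem_rootsOfUnity, ← map_pow, Subtype.ext (a1 := z ^ n) (a2 := 1) (hn z z.2), map_one]
  rw [Subgroup.relIndex, hker, Subgroup.index_ker,
    ← HasEnoughRootsOfUnity.natCard_rootsOfUnity k n]
  exact Subgroup.card_dvd_of_le hrange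

end Representations

section Codegrees

variable {G : Type*} [Group G] [Finite G]

theorem codegree_character {V : Type*} [AddCommGroup V] [Module ℂ V] [FiniteDimensional ℂ V]
    (ρ : Representation ℂ G V) (hρ : ρ.character ∈ Irr G) :
    codegree ⟨ρ.character, hρ⟩ = ((MonoidHom.ker ρ).index : ℂ) / Module.finrank ℂ V := by
  have hker : ker ⟨ρ.character, hρ⟩ = MonoidHom.ker ρ :=
    Subgroup.ext (character_eq_iff_mem_ker ρ)
  rw [codegree, hker, ← Representation.char_one ρ]

theorem index_ker_div_finrank_mem_cod {V : Type*} [AddCommGroup V] [Module ℂ V]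
    [FiniteDimensional ℂ V] {ρ : Representation ℂ G V} (hρ : ρ.IsIrreducible) :
    ((MonoidHom.ker ρ).index : ℂ) / Module.finrank ℂ V ∈ cod G := by
  let e := (Module.finBasis ℂ V).equivFun
  let σ : Representation ℂ G (Fin (Module.finrank ℂ V) → ℂ) := e.conjRingEquiv.toMonoidHom.comp ρ
  have hker : MonoidHom.ker σ = MonoidHom.ker ρ :=
    Subgroup.ext fun g => map_eq_one_iff e.conjRingEquiv e.conjRingEquiv.injective
  have hσ : σ.character ∈ Irr G := ⟨_, _, _, inferInstance, σ, isIrreducible_conj hρ e, rfl⟩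
  refine ⟨⟨σ.character, hσ⟩, ?_⟩
  rw [codegree_character, hker, Module.finrank_fin_fun]

theorem cod_subset_of_surjective {H : Type*} [Group H] [Finite H] {f : G →* H}
    (hf : Function.Surjective f) : cod H ⊆ cod G := by
  rintro _ ⟨⟨χ, hχ⟩, rfl⟩
  obtain ⟨V, _, _, _, ρ, hρ, rfl⟩ := id hχ
  have hindex : (MonoidHom.ker (ρ.comp f)).index = (MonoidHom.ker ρ).index := by
    rw [← MonoidHom.comap_ker, Subgroup.index_comap_of_surjective _ hf]
  rw [codegree_character, ← hindex]
  exact index_ker_div_finrank_mem_cod (isIrreducible_comp hρ hf)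

theorem card_range_mem_cod (φ : G →* ℂˣ) : (Nat.card φ.range : ℂ) ∈ cod G := by
  let ρ : Representation ℂ G ℂ :=
    (Algebra.lmul ℂ ℂ : ℂ →* Module.End ℂ ℂ).comp ((Units.coeHom ℂ).comp φ)
  have hker : MonoidHom.ker ρ = φ.ker := by
    ext g
    rw [MonoidHom.mem_ker, MonoidHom.mem_ker, ← Units.val_inj]
    refine ⟨fun h => by simpa [ρ] using LinearMap.congr_fun h 1, fun h => ?_⟩
    ext
    simpa [ρ] using h
  have h := index_ker_div_finrank_mem_cod
    (isIrreducible_of_finrank_eq_one (ρ := ρ) (Module.finrank_self ℂ))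
  rwa [hker, Subgroup.index_ker, Module.finrank_self, Nat.cast_one, div_one] at h

theorem card_range_eq_orderOf {R : Type*} [CommRing R] [IsDomain R] (φ : G →* Rˣ) :
    Nat.card φ.range = orderOf φ := by
  refine Nat.dvd_antisymm ?_ (orderOf_dvd_of_pow_eq_one ?_)
  · have : Finite φ.range := Finite.of_surjective _ φ.rangeRestrict_surjective
    rw [← IsCyclic.exponent_eq_card, Monoid.exponent_dvd_iff_forall_pow_eq_one]
    rintro ⟨_, g, rfl⟩
    exact Subtype.ext (DFunLike.congr_fun (pow_orderOf_eq_one φ) g)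
  · ext g
    exact congrArg (fun x : φ.range => ((x : Rˣ) : R)) (pow_card_eq_one' (x := φ.rangeRestrict g))

theorem natCast_mem_cod_of_dvd_exponent {n : ℕ}
    (hn : n ∣ Monoid.exponent (Abelianization G)) : (n : ℂ) ∈ cod G := by
  obtain ⟨e⟩ := CommGroup.monoidHom_mulEquiv_of_hasEnoughRootsOfUnity (Abelianization G) ℂ
  have : Finite (Abelianization G →* ℂˣ) := Finite.of_equiv _ e.symm.toEquiv
  obtain ⟨φ, hφ⟩ := Monoid.exists_orderOf_eq_exponent
    (Monoid.ExponentExists.of_finite (G := Abelianization G →* ℂˣ))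
  rw [Monoid.exponent_eq_of_mulEquiv e] at hφ
  have hord : orderOf (φ ^ (orderOf φ / n)) = n :=
    orderOf_pow_orderOf_div (orderOf_pos φ).ne' (hφ ▸ hn)
  have hmem := cod_subset_of_surjective (QuotientGroup.mk'_surjective (commutator G))
    (card_range_mem_cod (φ ^ (orderOf φ / n)))
  rwa [card_range_eq_orderOf, hord] at hmem

end Codegrees

section ClassTwo

variable {H : Type*} [Group H] {p : ℕ} [Fact p.Prime]

theorem le_center_of_disjoint_commutator {K : Subgroup H} [K.Normal]
    (hK : Disjoint K (commutator H)) : K ≤ Subgroup.center H := by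
  rw [← Subgroup.commutator_top_right_eq_bot_iff_le_center, ← le_bot_iff]
  exact hK (Subgroup.commutator_top_right_le_iff.2 ‹_›) (Subgroup.commutator_mono le_top le_rfl)

variable [Finite H]

theorem exists_isIrreducible_disjoint_ker (hcard : (Nat.card (commutator H)).Prime) :
    ∃ (n : ℕ) (ρ : Representation ℂ H (Fin n → ℂ)),
      ρ.IsIrreducible ∧ Disjoint (MonoidHom.ker ρ) (commutator H) := by
  have := Finite.one_lt_card_iff_nontrivial.1 hcard.one_lt
  obtain ⟨c, hc⟩ := exists_ne (1 : commutator H)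
  obtain ⟨n, ρ, hρ, hρc⟩ := exists_isIrreducible_apply_ne_one (k := ℂ)
    fun h : (c : H) = 1 => hc (Subtype.ext h)
  refine ⟨n, ρ, hρ, Subgroup.disjoint_def.2 fun {x} hx hx' => ?_⟩
  have := Fact.mk hcard
  by_contra hx1
  obtain ⟨i, hi⟩ : c ∈ Subgroup.zpowers (⟨x, hx'⟩ : commutator H) :=
    mem_zpowers_of_prime_card rfl fun h => hx1 (congrArg Subtype.val h)
  refine hρc ?_
  rw [← hi]
  exact zpow_mem hx i

theorem isSquare_index_center (hcard : (Nat.card (commutator H)).Prime)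
    (hle : commutator H ≤ Subgroup.center H) : IsSquare (Subgroup.center H).index := by
  obtain ⟨n, ρ, hρ, hker⟩ := exists_isIrreducible_disjoint_ker hcard
  rw [← finrank_sq_eq_index_center_of_disjoint_ker hρ hle hker]
  exact IsSquare.sq _

theorem mul_mem_cod_of_index_center_eq_sq (hcard : Nat.card (commutator H) = p)
    (hle : commutator H ≤ Subgroup.center H) {d : ℕ} (hd : (Subgroup.center H).index = d ^ 2)
    (hpow : ∀ z ∈ Subgroup.center H, z ^ p = 1) : (p * d : ℂ) ∈ cod H := by
  have hp : p.Prime := Fact.out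
  obtain ⟨n, ρ, hρ, hker⟩ := exists_isIrreducible_disjoint_ker (hcard.symm ▸ hp)
  have hdim : Module.finrank ℂ (Fin n → ℂ) = d :=
    Nat.pow_left_injective two_ne_zero
      ((finrank_sq_eq_index_center_of_disjoint_ker hρ hle hker).trans hd)
  have hkerc := le_center_of_disjoint_commutator hker
  have hrel : (MonoidHom.ker ρ).relIndex (Subgroup.center H) = p := by
    refine ((Nat.dvd_prime hp).1 (relIndex_ker_center_dvd hρ hpow)).resolve_left fun h => ?_
    have := hker.eq_bot_of_ge (hle.trans (Subgroup.relIndex_eq_one.1 h))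
    rw [this, Subgroup.card_bot] at hcard
    exact hp.ne_one hcard.symm
  have hmem := index_ker_div_finrank_mem_cod hρ
  have hd0 : (d : ℂ) ≠ 0 := by
    rw [Nat.cast_ne_zero]
    rintro rfl
    exact (Subgroup.center H).index_ne_zero_of_finite hd
  rwa [← Subgroup.relIndex_mul_index hkerc, hrel, hd, hdim, Nat.cast_mul, Nat.cast_pow, pow_two,
    ← mul_assoc, mul_div_cancel_right₀ _ hd0] at hmem

end ClassTwo

section Commutators

variable {G : Type*} [Group G]

theorem card_mul_relIndex {A B : Subgroup G} (h : A ≤ B) :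
    Nat.card A * A.relIndex B = Nat.card B := by
  rw [← Subgroup.relIndex_bot_left A, Subgroup.relIndex_mul_relIndex _ _ _ bot_le h,
    Subgroup.relIndex_bot_left]

theorem le_of_lt_inf_of_prime_relIndex {A B K : Subgroup G} (hAB : (A.relIndex B).Prime)
    (h : A < K ⊓ B) : B ≤ K := by
  have hmul := Subgroup.relIndex_mul_relIndex _ _ _ h.le inf_le_right
  rcases (Nat.dvd_prime hAB).1 (Dvd.intro_left _ hmul) with h1 | h1
  · exact (Subgroup.relIndex_eq_one.1 h1).trans inf_le_left
  · rw [h1] at hmul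
    exact absurd (Subgroup.relIndex_eq_one.1 (Nat.eq_of_mul_eq_mul_right hAB.pos
      (hmul.trans (one_mul _).symm))) h.not_ge

theorem eq_top_of_lt_of_prime_index {A B : Subgroup G} (hA : A.index.Prime) (h : A < B) :
    B = ⊤ := by
  rw [← Subgroup.relIndex_top_right] at hA
  exact top_le_iff.1 (le_of_lt_inf_of_prime_relIndex hA (by rwa [inf_top_eq]))

theorem mem_center_iff_centralizer_singleton_eq_top {c : G} :
    c ∈ Subgroup.center G ↔ Subgroup.centralizer {c} = ⊤ := by
  rw [Subgroup.centralizer_eq_top_iff_subset, Set.singleton_subset_iff, SetLike.mem_coe]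

theorem le_centralizer_singleton_of_mem_centralizer {A : Subgroup G} {c : G}
    (hc : c ∈ Subgroup.centralizer (A : Set G)) : A ≤ Subgroup.centralizer {c} :=
  fun a ha => Subgroup.mem_centralizer_singleton_iff.2 (Subgroup.mem_centralizer_iff.1 hc a ha)

theorem lt_centralizer_centralizer_inf {A K : Subgroup G} (hA : A ≤ Subgroup.center G) (hAK : A ≤ K)
    {c : G} (hcK : c ∈ K) (hcA : c ∉ A) :
    A < Subgroup.centralizer (Subgroup.centralizer {c} : Set G) ⊓ K := by
  have hc : c ∈ Subgroup.centralizer (Subgroup.centralizer {c} : Set G) :=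
    Subgroup.mem_centralizer_iff.2 fun u hu => Subgroup.mem_centralizer_singleton_iff.1 hu
  exact SetLike.lt_iff_le_and_exists.2
    ⟨le_inf (hA.trans (Subgroup.center_le_centralizer _)) hAK, c, Subgroup.mem_inf.2 ⟨hc, hcK⟩, hcA⟩

theorem mem_center_of_prime_index {A : Subgroup G} (hA : A.index.Prime) {x c : G} (hx : x ∉ A)
    (hcA : c ∈ Subgroup.centralizer (A : Set G)) (hcx : c ∈ Subgroup.centralizer {x}) :
    c ∈ Subgroup.center G :=
  mem_center_iff_centralizer_singleton_eq_top.2 <| eq_top_of_lt_of_prime_index hA <|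
    SetLike.lt_iff_le_and_exists.2 ⟨le_centralizer_singleton_of_mem_centralizer hcA, x,
      Subgroup.mem_centralizer_singleton_iff.2 (Subgroup.mem_centralizer_singleton_iff.1 hcx).symm,
      hx⟩

theorem center_le_of_prime_index {A : Subgroup G} (hA : A.index.Prime) (hAA : ⁅A, A⁆ = ⊥)
    (htop : Subgroup.center G ≠ ⊤) : Subgroup.center G ≤ A := by
  intro z hz
  by_contra hzA
  have hle : A ≤ Subgroup.center G := fun a ha =>
    mem_center_of_prime_index hA hzA (Subgroup.commutator_eq_bot_iff_le_centralizer.1 hAA ha)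
      (Subgroup.mem_centralizer_singleton_iff.2 (Subgroup.mem_center_iff.1 hz a))
  exact htop (eq_top_of_lt_of_prime_index hA (SetLike.lt_iff_le_and_exists.2 ⟨hle, z, hz, hzA⟩))

theorem commutator_self_eq_bot_of_relIndex_dvd_prime {p : ℕ} [Fact p.Prime] {S T : Subgroup G}
    (hTS : T ≤ Subgroup.centralizer S) (h : S.relIndex T ∣ p) : ⁅T, T⁆ = ⊥ := by
  have hle : S.subgroupOf T ≤ Subgroup.center T := fun s hs =>
    Subgroup.mem_center_iff.2 fun t =>
      Subtype.ext (Subgroup.mem_centralizer_iff.1 (hTS t.2) s hs).symm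
  have hcyc : IsCyclic (T ⧸ Subgroup.center T) :=
    isCyclic_of_card_dvd_prime ((Subgroup.index_dvd_of_le hle).trans h)
  exact Subgroup.commutator_self_eq_bot_iff.2 (isMulCommutative_of_isCyclic_quotient_center_self T)

/-- The homomorphism `b ↦ ⁅w, b⁆` on a subgroup `B` all of whose commutators with `w` lie in the
central subgroup `C`. It bounds the index of the centralizer of `w` in `B`. -/
def commutatorHom (w : G) {B C : Subgroup G} (hC : C ≤ Subgroup.center G)
    (h : ∀ b ∈ B, ⁅w, b⁆ ∈ C) : B →* C :=
  MonoidHom.mk' (fun b => ⟨⁅w, b⁆, h b b.2⟩) fun a b => Subtype.ext <|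
    have hcomm : (a : G) * ⁅w, (b : G)⁆ = ⁅w, (b : G)⁆ * a :=
      Subgroup.mem_center_iff.1 (hC (h b b.2)) a
    calc ⁅w, (a * b : G)⁆ = ⁅w, (a : G)⁆ * (a * ⁅w, (b : G)⁆ * (a : G)⁻¹) := by
          simp only [commutatorElement_mul_right_eq_mul_conj, mul_assoc]
      _ = ⁅w, (a : G)⁆ * ⁅w, (b : G)⁆ := by rw [hcomm, mul_inv_cancel_right]

theorem ker_commutatorHom (w : G) {B C : Subgroup G} (hC : C ≤ Subgroup.center G)
    (h : ∀ b ∈ B, ⁅w, b⁆ ∈ C) :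
    (commutatorHom w hC h).ker = (Subgroup.centralizer {w}).subgroupOf B := by
  ext b
  rw [MonoidHom.mem_ker, Subgroup.mem_subgroupOf, Subgroup.mem_centralizer_singleton_iff,
    eq_comm (a := (b : G) * w), ← commutatorElement_eq_one_iff_mul_comm, ← Subtype.val_inj]
  rfl

theorem relIndex_centralizer_dvd (w : G) {B C : Subgroup G} (hC : C ≤ Subgroup.center G)
    (h : ∀ b ∈ B, ⁅w, b⁆ ∈ C) : (Subgroup.centralizer {w}).relIndex B ∣ Nat.card C := by
  rw [Subgroup.relIndex, ← ker_commutatorHom w hC h, Subgroup.index_ker]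
  exact Subgroup.card_subgroup_dvd_card _

theorem index_centralizer_dvd (w : G) {C : Subgroup G} (hC : C ≤ Subgroup.center G)
    (h : ∀ b, ⁅w, b⁆ ∈ C) : (Subgroup.centralizer {w}).index ∣ Nat.card C := by
  rw [← Subgroup.relIndex_top_right]
  exact relIndex_centralizer_dvd w hC fun b _ => h b

/-- `g ↦ ⁅z, g⁆` is a homomorphism into an abelian group, so it is trivial on commutators. -/
theorem commutator_le_centralizer_singleton {z : G} (h : ∀ g, ⁅z, g⁆ ∈ Subgroup.center G) :
    commutator G ≤ Subgroup.centralizer {z} := by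
  let φ : (⊤ : Subgroup G) →* Subgroup.center G := commutatorHom z le_rfl fun g _ => h g
  rw [commutator_def, Subgroup.commutator_le]
  intro a ha b hb
  have hmem : ⁅(⟨a, ha⟩ : (⊤ : Subgroup G)), ⟨b, hb⟩⁆ ∈ φ.ker := by
    rw [MonoidHom.mem_ker, map_commutatorElement, commutatorElement_eq_one_iff_mul_comm]
    exact mul_comm' _ _
  rwa [ker_commutatorHom] at hmem

theorem commutatorElement_pow_left {z g : G} (h : Commute ⁅z, g⁆ z) (n : ℕ) :
    ⁅z ^ n, g⁆ = ⁅z, g⁆ ^ n := by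
  have hconj : g * z * g⁻¹ = ⁅z, g⁆⁻¹ * z := by rw [commutatorElement_def]; group
  have hconj_pow : g * z ^ n * g⁻¹ = (⁅z, g⁆ ^ n)⁻¹ * z ^ n := by
    rw [← conj_pow, hconj, h.inv_left.mul_pow, inv_pow]
  calc ⁅z ^ n, g⁆ = z ^ n * (g * z ^ n * g⁻¹)⁻¹ := by rw [commutatorElement_def]; group
    _ = ⁅z, g⁆ ^ n := by rw [hconj_pow]; group

theorem commutatorElement_pow_right {z g : G} (h : Commute ⁅z, g⁆ g) (n : ℕ) :
    ⁅z, g ^ n⁆ = ⁅z, g⁆ ^ n := by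
  rw [← commutatorElement_inv, commutatorElement_pow_left, ← commutatorElement_inv z g, inv_pow,
    inv_inv]
  rw [← commutatorElement_inv]
  exact h.inv_left

/-- `⁅z ^ n, g⁆ = ⁅z, g ^ n⁆`, and `z` centralizes the commutator subgroup. -/
theorem pow_mem_center_of_pow_mem_commutator {n : ℕ} (hn : ∀ g : G, g ^ n ∈ commutator G) {z : G}
    (hz : ∀ g, ⁅z, g⁆ ∈ Subgroup.center G) : z ^ n ∈ Subgroup.center G := by
  refine Subgroup.mem_center_iff.2 fun g => ?_
  have hcomm (h : G) : Commute ⁅z, g⁆ h := (Subgroup.mem_center_iff.1 (hz g) h).symm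
  have hzg := Subgroup.mem_centralizer_singleton_iff.1
    (commutator_le_centralizer_singleton hz (hn g))
  rw [eq_comm, ← commutatorElement_eq_one_iff_mul_comm, commutatorElement_pow_left (hcomm z),
    ← commutatorElement_pow_right (hcomm g), commutatorElement_eq_one_iff_mul_comm, hzg]

theorem normal_of_commutator_top_le {B M : Subgroup G} (hMB : M ≤ B) (h : ⁅B, ⊤⁆ ≤ M) :
    M.Normal :=
  Subgroup.commutator_top_right_le_iff.1 ((Subgroup.commutator_mono hMB le_rfl).trans h)

theorem commutator_top_lt [Group.IsNilpotent G] {B : Subgroup G} [B.Normal] (hB : B ≠ ⊥) :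
    ⁅B, ⊤⁆ < B := by
  refine lt_of_le_of_ne (Subgroup.commutator_le_left B ⊤) fun h => hB ?_
  have hle (n : ℕ) : B ≤ (⊤ : Subgroup G).lowerCentralSeries n := by
    induction n with
    | zero => exact le_top
    | succ n ih =>
      rw [Subgroup.lowerCentralSeries_succ, ← h]
      exact Subgroup.commutator_mono ih le_rfl
  obtain ⟨n, hn⟩ := Subgroup.nilpotent_iff_lowerCentralSeries.1 ‹Group.IsNilpotent G›
  exact le_bot_iff.1 (hn ▸ hle n)

theorem map_mk'_commutator (M : Subgroup G) [M.Normal] :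
    (commutator G).map (QuotientGroup.mk' M) = commutator (G ⧸ M) := by
  rw [map_commutator_eq, MonoidHom.range_eq_top.2 (QuotientGroup.mk'_surjective M),
    ← commutator_def]

theorem card_map_mk' (B M : Subgroup G) [M.Normal] :
    Nat.card (B.map (QuotientGroup.mk' M)) = M.relIndex B := by
  rw [← Subgroup.relIndex_ker, QuotientGroup.ker_mk']

theorem card_commutator_quotient (M : Subgroup G) [M.Normal] :
    Nat.card (commutator (G ⧸ M)) = M.relIndex (commutator G) := by
  rw [← map_mk'_commutator, card_map_mk']

theorem index_commutator_quotient {M : Subgroup G} [M.Normal] (hM : M ≤ commutator G) :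
    (commutator (G ⧸ M)).index = (commutator G).index := by
  rw [← map_mk'_commutator, Subgroup.index_map_eq _ (QuotientGroup.mk'_surjective M)]
  rwa [QuotientGroup.ker_mk']

theorem mk_mem_center_iff {M : Subgroup G} [M.Normal] {z : G} :
    QuotientGroup.mk' M z ∈ Subgroup.center (G ⧸ M) ↔ ∀ g, ⁅z, g⁆ ∈ M := by
  rw [Subgroup.mem_center_iff, (QuotientGroup.mk'_surjective M).forall]
  refine forall_congr' fun g => ?_
  rw [eq_comm, ← commutatorElement_eq_one_iff_mul_comm, ← map_commutatorElement,
    ← MonoidHom.mem_ker, QuotientGroup.ker_mk']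

theorem commutator_quotient_le_center {M : Subgroup G} [M.Normal] (h : ⁅commutator G, ⊤⁆ ≤ M) :
    commutator (G ⧸ M) ≤ Subgroup.center (G ⧸ M) := by
  rw [← map_mk'_commutator]
  rintro _ ⟨c, hc, rfl⟩
  exact mk_mem_center_iff.2 fun g =>
    h (Subgroup.commutator_mem_commutator hc (Subgroup.mem_top g))

end Commutators

section PGroups

variable {G : Type*} [Group G] [Finite G] {p : ℕ} [Fact p.Prime]

theorem prime_dvd_relIndex_of_lt (hG : IsPGroup p G) {A B : Subgroup G} (h : A < B) :
    p ∣ A.relIndex B := by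
  obtain ⟨k, hk⟩ := (hG.to_subgroup B).index (A.subgroupOf B)
  rw [Subgroup.relIndex, hk]
  refine dvd_pow_self p fun h0 => h.not_ge (Subgroup.relIndex_eq_one.1 ?_)
  rw [Subgroup.relIndex, hk, h0, pow_zero]

theorem exists_between_card_eq_pow {A B : Subgroup G} (h : A ≤ B) {m : ℕ}
    (hA : Nat.card A ∣ p ^ m) (hB : p ^ m ∣ Nat.card B) :
    ∃ M, A ≤ M ∧ M ≤ B ∧ Nat.card M = p ^ m := by
  obtain ⟨a, ham, ha⟩ := (Nat.dvd_prime_pow Fact.out).1 hA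
  obtain ⟨K, hK, hAK⟩ := Sylow.exists_subgroup_card_pow_prime_le p hB (A.subgroupOf B)
    ((Nat.card_congr (Subgroup.subgroupOfEquivOfLe h).toEquiv).trans ha) ham
  refine ⟨K.map B.subtype, fun x hx => ⟨⟨x, h hx⟩, hAK hx, rfl⟩, Subgroup.map_subtype_le K, ?_⟩
  rw [Subgroup.card_map_of_injective B.subtype_injective, hK]

theorem exists_normal_relIndex_eq_prime (hG : IsPGroup p G) {A B : Subgroup G} (h : A < B)
    (hc : ⁅B, ⊤⁆ ≤ A) : ∃ M : Subgroup G, M.Normal ∧ A ≤ M ∧ M ≤ B ∧ M.relIndex B = p := by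
  have hp : 0 < p := Nat.Prime.pos Fact.out
  obtain ⟨b, hb⟩ := IsPGroup.iff_card.1 (hG.to_subgroup B)
  have hAp : Nat.card A * p ∣ p ^ b := by
    rw [← hb, ← card_mul_relIndex h.le]
    exact mul_dvd_mul_left _ (prime_dvd_relIndex_of_lt hG h)
  obtain _ | b := b
  · exact absurd (Nat.dvd_one.1 (dvd_of_mul_left_dvd hAp)) (Nat.Prime.ne_one Fact.out)
  rw [pow_succ] at hb hAp
  obtain ⟨M, hAM, hMB, hM⟩ := exists_between_card_eq_pow h.le
    (Nat.dvd_of_mul_dvd_mul_right hp hAp) (hb ▸ dvd_mul_right _ _)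
  refine ⟨M, normal_of_commutator_top_le hMB (hc.trans hAM), hAM, hMB, ?_⟩
  have hcard := card_mul_relIndex hMB
  rw [hM, hb] at hcard
  exact Nat.eq_of_mul_eq_mul_left (pow_pos hp b) hcard

theorem commutator_le_of_index_eq_prime (hG : IsPGroup p G) {U : Subgroup G} (hU : U.index = p) :
    commutator G ≤ U := by
  have hp : p.Prime := Fact.out
  have hnil := hG.isNilpotent
  have hcoatom : IsCoatom U := by
    refine ⟨fun h => hp.ne_one ?_, fun B hB => eq_top_of_lt_of_prime_index (hU.symm ▸ hp) hB⟩
    rw [← hU, h, Subgroup.index_top]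
  have hnormal : U.Normal :=
    Subgroup.NormalizerCondition.normal_of_coatom U Group.normalizerCondition_of_isNilpotent hcoatom
  have hcyc : IsCyclic (G ⧸ U) := isCyclic_of_prime_card hU
  exact (Subgroup.Normal.quotient_commutative_iff_commutator_le).1 ⟨⟨mul_comm'⟩⟩

theorem pow_mem_commutator_of_not_dvd_exponent (hG : IsPGroup p G)
    (h : ¬ p ^ 2 ∣ Monoid.exponent (Abelianization G)) (x : G) : x ^ p ∈ commutator G := by
  obtain ⟨j, hj⟩ := isPGroup_iff_exponent_eq_pow.1 (hG.to_quotient (commutator G))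
  have hj2 : j < 2 := not_le.1 fun hj2 => h (hj ▸ pow_dvd_pow p hj2)
  have hdvd : Monoid.exponent (Abelianization G) ∣ p ^ 1 := hj ▸ pow_dvd_pow p (by omega)
  rw [pow_one] at hdvd
  rw [← Abelianization.ker_of, MonoidHom.mem_ker, map_pow]
  exact Monoid.exponent_dvd_iff_forall_pow_eq_one.1 hdvd _

theorem le_center_of_card_eq_prime (hG : IsPGroup p G) {Z : Subgroup G} [Z.Normal]
    (hZ : Nat.card Z = p) : Z ≤ Subgroup.center G := by
  have hp : p.Prime := Fact.out
  have hnil := hG.isNilpotent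
  have hne : Z ≠ ⊥ := fun h => hp.ne_one (by rw [← hZ, h, Subgroup.card_bot])
  rw [← Subgroup.commutator_top_right_eq_bot_iff_le_center]
  by_contra hbot
  have hprime : ((⊥ : Subgroup G).relIndex Z).Prime := by rwa [Subgroup.relIndex_bot_left, hZ]
  exact (commutator_top_lt hne).not_ge
    (le_of_lt_inf_of_prime_relIndex hprime
      (by rw [inf_eq_left.2 (commutator_top_lt hne).le]; exact bot_lt_iff_ne_bot.2 hbot))

end PGroups

section Criteria

variable {G : Type*} [Group G] {p : ℕ} [Fact p.Prime]

theorem index_center_dvd_sq_of_index_eq_prime (hcard : Nat.card (commutator G) = p)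
    (hle : commutator G ≤ Subgroup.center G) {A : Subgroup G} (hA : A.index = p)
    (hAA : ⁅A, A⁆ = ⊥) : (Subgroup.center G).index ∣ p ^ 2 := by
  have hp : A.index.Prime := hA.symm ▸ Fact.out
  obtain ⟨x, hx⟩ : ∃ x, x ∉ A := by
    by_contra! h
    exact hp.ne_one (Subgroup.index_eq_one.2 ((Subgroup.eq_top_iff' A).2 h))
  have hcenter : Subgroup.centralizer {x} ⊓ A ≤ Subgroup.center G := fun a ha =>
    mem_center_of_prime_index hp hx (Subgroup.commutator_eq_bot_iff_le_centralizer.1 hAA ha.2) ha.1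
  refine (Subgroup.index_dvd_of_le hcenter).trans ?_
  rw [← Subgroup.relIndex_mul_index inf_le_right, Subgroup.inf_relIndex_right, hA, sq]
  refine mul_dvd_mul_right (hcard ▸ relIndex_centralizer_dvd x hle fun b _ => ?_) p
  exact Subgroup.commutator_mem_commutator (Subgroup.mem_top x) (Subgroup.mem_top b)

variable [Finite G]

theorem index_center_eq_sq_of_dvd_cube (hcard : Nat.card (commutator G) = p)
    (hle : commutator G ≤ Subgroup.center G) (hidx : (Subgroup.center G).index ∣ p ^ 3) :
    (Subgroup.center G).index = p ^ 2 := by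
  have hp : p.Prime := Fact.out
  obtain ⟨r, hr⟩ := isSquare_index_center (hcard.symm ▸ hp) hle
  obtain ⟨i, -, rfl⟩ := (Nat.dvd_prime_pow hp).1 ((Dvd.intro_left r hr.symm).trans hidx)
  rw [← pow_add] at hr
  have hi : i + i ≤ 3 := (Nat.pow_dvd_pow_iff_le_right hp.one_lt).1 (hr ▸ hidx)
  have hi0 : i ≠ 0 := by
    rintro rfl
    have htop : Subgroup.center G = ⊤ := Subgroup.index_eq_one.1 hr
    rw [(commutator_eq_bot_iff_center_eq_top _).2 htop, Subgroup.card_bot] at hcard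
    exact hp.ne_one hcard.symm
  obtain rfl : i = 1 := by omega
  exact hr

theorem sq_mem_cod_of_index_center_dvd_cube (hcard : Nat.card (commutator G) = p)
    (hle : commutator G ≤ Subgroup.center G) (hidx : (Subgroup.center G).index ∣ p ^ 3)
    (hpow : ∀ z ∈ Subgroup.center G, z ^ p = 1) : (p : ℂ) ^ 2 ∈ cod G := by
  rw [sq]
  exact mul_mem_cod_of_index_center_eq_sq hcard hle
    (index_center_eq_sq_of_dvd_cube hcard hle hidx) hpow

theorem center_le_commutator_of_index_commutator_dvd_sq (hcard : Nat.card (commutator G) = p)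
    (hle : commutator G ≤ Subgroup.center G) (hidx : (commutator G).index ∣ p ^ 2) :
    Subgroup.center G ≤ commutator G := by
  have hcenter := index_center_eq_sq_of_dvd_cube hcard hle
    (((Subgroup.index_dvd_of_le hle).trans hidx).trans (pow_dvd_pow p (by norm_num)))
  rw [← Subgroup.relIndex_eq_one, ← Nat.dvd_one]
  rw [← Subgroup.relIndex_mul_index hle, hcenter] at hidx
  exact Nat.dvd_of_mul_dvd_mul_right (pow_pos (Nat.Prime.pos Fact.out) 2) (by rwa [one_mul])

theorem sq_mem_cod_of_index_eq_prime {M U : Subgroup G} [M.Normal]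
    (hM : M.relIndex (commutator G) = p) (hΓM : ⁅commutator G, ⊤⁆ ≤ M) (hU : U.index = p)
    (hMU : M ≤ U) (hUU : ⁅U, U⁆ ≤ M) (hpow : ∀ z ∈ U, (∀ g, ⁅z, g⁆ ∈ M) → z ^ p ∈ M) :
    (p : ℂ) ^ 2 ∈ cod G := by
  have hp : p.Prime := Fact.out
  have hsurj := QuotientGroup.mk'_surjective M
  have hcard : Nat.card (commutator (G ⧸ M)) = p := by rw [card_commutator_quotient, hM]
  have hle := commutator_quotient_le_center hΓM
  have hA : (U.map (QuotientGroup.mk' M)).index = p := by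
    rwa [Subgroup.index_map_eq _ hsurj (by rwa [QuotientGroup.ker_mk'])]
  have hAA : ⁅U.map (QuotientGroup.mk' M), U.map (QuotientGroup.mk' M)⁆ = ⊥ := by
    rwa [← Subgroup.map_commutator, Subgroup.map_eq_bot_iff, QuotientGroup.ker_mk']
  have htop : Subgroup.center (G ⧸ M) ≠ ⊤ := fun h => by
    rw [(commutator_eq_bot_iff_center_eq_top _).2 h, Subgroup.card_bot] at hcard
    exact hp.ne_one hcard.symm
  have hidx := (index_center_dvd_sq_of_index_eq_prime hcard hle hA hAA).trans
    (pow_dvd_pow p (by norm_num : 2 ≤ 3))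
  refine cod_subset_of_surjective hsurj
    (sq_mem_cod_of_index_center_dvd_cube hcard hle hidx fun y hy => ?_)
  obtain ⟨z, hz, rfl⟩ := center_le_of_prime_index (hA.symm ▸ hp) hAA htop hy
  rw [← map_pow, ← MonoidHom.mem_ker, QuotientGroup.ker_mk']
  exact hpow z hz (mk_mem_center_iff.1 hy)

theorem sq_mem_cod_of_index_commutator_dvd_sq (hG : IsPGroup p G) (hne : commutator G ≠ ⊥)
    (hidx : (commutator G).index ∣ p ^ 2) : (p : ℂ) ^ 2 ∈ cod G := by
  have hnil := hG.isNilpotent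
  obtain ⟨M, hMn, hΓM, hMle, hM⟩ :=
    exists_normal_relIndex_eq_prime hG (commutator_top_lt hne) le_rfl
  have hcard : Nat.card (commutator (G ⧸ M)) = p := by rw [card_commutator_quotient, hM]
  have hle := commutator_quotient_le_center hΓM
  rw [← index_commutator_quotient hMle] at hidx
  refine cod_subset_of_surjective (QuotientGroup.mk'_surjective M)
    (sq_mem_cod_of_index_center_dvd_cube hcard hle ?_ fun z hz => ?_)
  · exact ((Subgroup.index_dvd_of_le hle).trans hidx).trans (pow_dvd_pow p (by norm_num))
  · have hzc := center_le_commutator_of_index_commutator_dvd_sq hcard hle hidx hz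
    rw [← hcard]
    exact congrArg Subtype.val (pow_card_eq_one' (x := (⟨z, hzc⟩ : commutator (G ⧸ M))))

end Criteria

section ClassThree

variable {G : Type*} [Group G] [Finite G] {p : ℕ} [Fact p.Prime]

theorem relIndex_center_inf_commutator_eq_prime (hG : IsPGroup p G)
    (hΓ : Nat.card (⁅commutator G, ⊤⁆ : Subgroup G) = p) {U : Subgroup G} (hU : U.index = p)
    (hUc : U ≤ Subgroup.centralizer (commutator G)) :
    (Subgroup.center G ⊓ commutator G).relIndex (commutator G) = p := by
  have hp : p.Prime := Fact.out
  obtain ⟨w, hw⟩ : ∃ w, w ∉ U := by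
    by_contra! h
    exact hp.ne_one (hU ▸ Subgroup.index_eq_one.2 ((Subgroup.eq_top_iff' U).2 h))
  have heq : Subgroup.center G ⊓ commutator G = Subgroup.centralizer {w} ⊓ commutator G :=
    le_antisymm (inf_le_inf_right _ (Subgroup.center_le_centralizer _)) fun c hc =>
      ⟨mem_center_of_prime_index (hU.symm ▸ hp) hw (Subgroup.le_centralizer_iff.1 hUc hc.2) hc.1,
        hc.2⟩
  have hdvd : (Subgroup.center G ⊓ commutator G).relIndex (commutator G) ∣ p := by
    rw [heq, Subgroup.inf_relIndex_right, ← hΓ]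
    refine relIndex_centralizer_dvd w (le_center_of_card_eq_prime hG hΓ) fun b hb => ?_
    rw [Subgroup.commutator_comm]
    exact Subgroup.commutator_mem_commutator (Subgroup.mem_top w) hb
  refine ((Nat.dvd_prime hp).1 hdvd).resolve_left fun h => hp.ne_one ?_
  rw [← hΓ, Subgroup.card_eq_one, Subgroup.commutator_top_right_eq_bot_iff_le_center]
  exact (Subgroup.relIndex_eq_one.1 h).trans inf_le_left

theorem sq_mem_cod_of_le_centralizer_commutator (hG : IsPGroup p G)
    (hexp : ∀ x : G, x ^ p ∈ commutator G)
    (hΓ : Nat.card (⁅commutator G, ⊤⁆ : Subgroup G) = p) {U : Subgroup G} (hU : U.index = p)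
    (hUc : U ≤ Subgroup.centralizer (commutator G)) : (p : ℂ) ^ 2 ∈ cod G := by
  have hUU : ⁅U, U⁆ ≤ Subgroup.center G :=
    (Subgroup.commutator_mono hUc hUc).trans (commutator_centralizer_commutator_le_center G)
  refine sq_mem_cod_of_index_eq_prime (M := Subgroup.center G ⊓ commutator G)
    (relIndex_center_inf_commutator_eq_prime hG hΓ hU hUc)
    (le_inf (le_center_of_card_eq_prime hG hΓ) (Subgroup.commutator_le_left _ _)) hU
    (inf_le_right.trans (commutator_le_of_index_eq_prime hG hU))
    (le_inf hUU (Subgroup.commutator_mono le_top le_top)) fun z _ hz => ?_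
  exact ⟨pow_mem_center_of_pow_mem_commutator hexp fun g => (hz g).1, hexp z⟩

theorem sq_mem_cod_of_not_le_centralizer_commutator (hG : IsPGroup p G)
    (hexp : ∀ x : G, x ^ p ∈ commutator G)
    (hΓ : Nat.card (⁅commutator G, ⊤⁆ : Subgroup G) = p) {U : Subgroup G} (hU : U.index = p)
    (hUU : ⁅U, U⁆ ≤ ⁅commutator G, ⊤⁆) (hUc : ¬ U ≤ Subgroup.centralizer (commutator G)) :
    (p : ℂ) ^ 2 ∈ cod G := by
  have hΓc := le_center_of_card_eq_prime hG hΓ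
  have hlt : Subgroup.centralizer U ⊓ commutator G < commutator G :=
    inf_le_right.lt_of_ne fun h => hUc (Subgroup.le_centralizer_iff.1 (inf_eq_right.1 h))
  have hΓD : ⁅commutator G, ⊤⁆ ≤ Subgroup.centralizer U ⊓ commutator G :=
    le_inf (hΓc.trans (Subgroup.center_le_centralizer _)) (Subgroup.commutator_le_left _ _)
  obtain ⟨M, hMn, hDM, hMle, hM⟩ := exists_normal_relIndex_eq_prime hG hlt hΓD
  refine sq_mem_cod_of_index_eq_prime hM (hΓD.trans hDM) hU
    (hMle.trans (commutator_le_of_index_eq_prime hG hU)) (hUU.trans (hΓD.trans hDM))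
    fun z hz _ => hDM ⟨Subgroup.mem_centralizer_iff.2 fun u hu => ?_, hexp z⟩
  have hmem : ⁅z, u⁆ ∈ ⁅commutator G, (⊤ : Subgroup G)⁆ :=
    hUU (Subgroup.commutator_mem_commutator hz hu)
  have hpow : ⁅z, u⁆ ^ p = 1 := by
    rw [← hΓ]
    exact congrArg Subtype.val
      (pow_card_eq_one' (x := (⟨⁅z, u⁆, hmem⟩ : (⁅commutator G, ⊤⁆ : Subgroup G))))
  rw [eq_comm, ← commutatorElement_eq_one_iff_mul_comm, commutatorElement_pow_left
    (Subgroup.mem_center_iff.1 (hΓc hmem) z).symm, hpow]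

theorem sq_mem_cod_of_card_eq_prime_of_relIndex_eq_prime (hG : IsPGroup p G)
    (hexp : ∀ x : G, x ^ p ∈ commutator G)
    (hΓ : Nat.card (⁅commutator G, ⊤⁆ : Subgroup G) = p)
    (hrel : (⁅commutator G, ⊤⁆ : Subgroup G).relIndex (commutator G) = p) :
    (p : ℂ) ^ 2 ∈ cod G := by
  have hp : p.Prime := Fact.out
  have hΓc := le_center_of_card_eq_prime hG hΓ
  obtain ⟨c, hc, hcz⟩ : ∃ c ∈ commutator G, c ∉ Subgroup.center G := by
    by_contra! h
    rw [← SetLike.le_def, ← Subgroup.commutator_top_right_eq_bot_iff_le_center] at h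
    rw [h, Subgroup.card_bot] at hΓ
    exact hp.ne_one hΓ.symm
  have hdvd : (Subgroup.centralizer {c}).index ∣ p :=
    hΓ ▸ index_centralizer_dvd c hΓc fun b =>
      Subgroup.commutator_mem_commutator hc (Subgroup.mem_top b)
  have hU : (Subgroup.centralizer {c}).index = p :=
    ((Nat.dvd_prime hp).1 hdvd).resolve_left fun h =>
      hcz (mem_center_iff_centralizer_singleton_eq_top.2 (Subgroup.index_eq_one.1 h))
  have hlt := lt_centralizer_centralizer_inf hΓc (Subgroup.commutator_le_left _ _) hc
    fun h => hcz (hΓc h)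
  exact sq_mem_cod_of_le_centralizer_commutator hG hexp hΓ hU
    (Subgroup.le_centralizer_iff.1 (le_of_lt_inf_of_prime_relIndex (hrel.symm ▸ hp) hlt))

theorem sq_mem_cod_of_relIndex_eq_prime (hG : IsPGroup p G)
    (hexp : ∀ x : G, x ^ p ∈ commutator G) (hne : (⁅commutator G, ⊤⁆ : Subgroup G) ≠ ⊥)
    (hrel : (⁅commutator G, ⊤⁆ : Subgroup G).relIndex (commutator G) = p) :
    (p : ℂ) ^ 2 ∈ cod G := by
  have hnil := hG.isNilpotent
  obtain ⟨L, hLn, -, hLΓ, hL⟩ := exists_normal_relIndex_eq_prime hG (commutator_top_lt hne) le_rfl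
  have hsurj := QuotientGroup.mk'_surjective L
  have hmap : (⁅commutator G, ⊤⁆ : Subgroup G).map (QuotientGroup.mk' L) =
      ⁅commutator (G ⧸ L), ⊤⁆ := by
    rw [Subgroup.map_commutator, map_mk'_commutator, Subgroup.map_top_of_surjective _ hsurj]
  have hcard : Nat.card (⁅commutator (G ⧸ L), ⊤⁆ : Subgroup (G ⧸ L)) = p := by
    rw [← hmap, card_map_mk', hL]
  refine cod_subset_of_surjective hsurj
    (sq_mem_cod_of_card_eq_prime_of_relIndex_eq_prime (hG.to_quotient L) ?_ hcard ?_)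
  · rw [← map_mk'_commutator, hsurj.forall]
    exact fun x => ⟨x ^ p, hexp x, map_pow _ x p⟩
  · rw [← hmap, ← map_mk'_commutator, Subgroup.relIndex_map_map, QuotientGroup.ker_mk',
      sup_eq_left.2 hLΓ, sup_eq_left.2 (hLΓ.trans (Subgroup.commutator_le_left _ _)), hrel]

end ClassThree

section OrderPowSix

variable {G : Type*} [Group G] [Finite G] {p : ℕ} [Fact p.Prime]

theorem exists_notMem_commutator_index_centralizer_dvd (hcard : Nat.card G = p ^ 5)
    (hcomm : Nat.card (commutator G) = p ^ 2) (hle : commutator G ≤ Subgroup.center G) :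
    ∃ z ∉ commutator G, (Subgroup.centralizer {z}).index ∣ p := by
  have hp : p.Prime := Fact.out
  have hidx : (commutator G).index = p ^ 3 := by
    have h := Subgroup.card_mul_index (commutator G)
    rw [hcomm, hcard, pow_add p 2 3] at h
    exact Nat.eq_of_mul_eq_mul_left (pow_pos hp.pos 2) h
  have hne : commutator G ≠ ⊥ := fun h => by
    rw [h, Subgroup.card_bot] at hcomm
    exact hp.ne_one (Nat.eq_one_of_mul_eq_one_left (by rw [hcomm, sq]))
  have hbot : ⁅commutator G, (⊤ : Subgroup G)⁆ = ⊥ :=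
    Subgroup.commutator_top_right_eq_bot_iff_le_center.2 hle
  obtain ⟨N, hNn, -, hNle, hN⟩ := exists_normal_relIndex_eq_prime (IsPGroup.of_card hcard)
    (bot_lt_iff_ne_bot.2 hne) hbot.le
  have hNcard : Nat.card N = p := by
    have h := card_mul_relIndex hNle
    rw [hN, hcomm, sq] at h
    exact Nat.eq_of_mul_eq_mul_right hp.pos h
  -- Modulo `N` the index of the centre is a square, hence not that of the commutator subgroup.
  obtain ⟨z, hzN, hz⟩ : ∃ z, (∀ g, ⁅z, g⁆ ∈ N) ∧ z ∉ commutator G := by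
    by_contra! h
    have hcq := commutator_quotient_le_center (hbot.le.trans bot_le : _ ≤ N)
    have hcenter : Subgroup.center (G ⧸ N) ≤ commutator (G ⧸ N) := by
      rw [← map_mk'_commutator]
      intro y hy
      obtain ⟨z, rfl⟩ := QuotientGroup.mk'_surjective N y
      exact Subgroup.mem_map_of_mem _ (h z (mk_mem_center_iff.1 hy))
    have hdvd := Subgroup.index_dvd_of_le hcq
    have hdvd' := Subgroup.index_dvd_of_le hcenter
    rw [index_commutator_quotient hNle, hidx] at hdvd hdvd'
    rw [index_center_eq_sq_of_dvd_cube (by rw [card_commutator_quotient, hN]) hcq hdvd] at hdvd'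
    exact absurd ((Nat.pow_dvd_pow_iff_le_right hp.one_lt).1 hdvd') (by norm_num)
  exact ⟨z, hz, hNcard ▸ index_centralizer_dvd z (hNle.trans hle) hzN⟩

theorem exists_index_eq_prime_commutator_self_eq_bot (hcard : Nat.card G = p ^ 5)
    (hcomm : Nat.card (commutator G) = p ^ 2) (hle : commutator G ≤ Subgroup.center G) :
    ∃ U : Subgroup G, U.index = p ∧ ⁅U, U⁆ = ⊥ := by
  have hp : p.Prime := Fact.out
  obtain ⟨z, hz, hC⟩ := exists_notMem_commutator_index_centralizer_dvd hcard hcomm hle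
  set C := Subgroup.centralizer {z}
  have hCcard : p ^ 4 ∣ Nat.card C := by
    refine Nat.dvd_of_mul_dvd_mul_right hp.pos ?_
    rw [← pow_succ, ← hcard, ← Subgroup.card_mul_index C]
    exact mul_dvd_mul_left _ hC
  have hlt : commutator G < Subgroup.centralizer C ⊓ C :=
    lt_centralizer_centralizer_inf hle (hle.trans (Subgroup.center_le_centralizer _))
      (Subgroup.mem_centralizer_singleton_iff.2 rfl) hz
  have hZcard : p ^ 3 ∣ Nat.card (Subgroup.centralizer C ⊓ C : Subgroup G) := by
    rw [← card_mul_relIndex hlt.le, hcomm, pow_succ]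
    exact mul_dvd_mul_left _ (prime_dvd_relIndex_of_lt (IsPGroup.of_card hcard) hlt)
  -- A subgroup `T` of `C` with a central subgroup `S` of index `p` is abelian.
  obtain ⟨S, -, hSle, hS⟩ := exists_between_card_eq_pow hlt.le
    (hcomm ▸ pow_dvd_pow p (by norm_num)) hZcard
  obtain ⟨T, hST, hTC, hT⟩ := exists_between_card_eq_pow (hSle.trans inf_le_right)
    (hS ▸ pow_dvd_pow p (by norm_num)) hCcard
  refine ⟨T, ?_, commutator_self_eq_bot_of_relIndex_dvd_prime (S := S) (p := p) ?_ ?_⟩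
  · have h := Subgroup.card_mul_index T
    rw [hT, hcard, pow_succ p 4] at h
    exact Nat.eq_of_mul_eq_mul_left (pow_pos hp.pos 4) h
  · exact Subgroup.le_centralizer_iff.1
      ((hSle.trans inf_le_left).trans (Subgroup.centralizer_le hTC))
  · have h := card_mul_relIndex hST
    rw [hS, hT, pow_succ p 3] at h
    exact (Nat.eq_of_mul_eq_mul_left (pow_pos hp.pos 3) h).dvd

theorem exists_index_eq_prime_commutator_self_le (hcard : Nat.card G = p ^ 6)
    (hcomm : Nat.card (commutator G) = p ^ 3)
    (hΓ : Nat.card (⁅commutator G, ⊤⁆ : Subgroup G) = p) :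
    ∃ U : Subgroup G, U.index = p ∧ ⁅U, U⁆ ≤ ⁅commutator G, ⊤⁆ := by
  have hp : p.Prime := Fact.out
  set Γ : Subgroup G := ⁅commutator G, ⊤⁆
  have hsurj := QuotientGroup.mk'_surjective Γ
  have hQ : Nat.card (G ⧸ Γ) = p ^ 5 := by
    have h := Subgroup.card_mul_index Γ
    rw [hΓ, hcard, pow_succ' p 5] at h
    exact Nat.eq_of_mul_eq_mul_left hp.pos h
  have hQ' : Nat.card (commutator (G ⧸ Γ)) = p ^ 2 := by
    have h := card_mul_relIndex (Subgroup.commutator_le_left _ _ : Γ ≤ commutator G)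
    rw [hΓ, hcomm, pow_succ' p 2] at h
    rw [card_commutator_quotient, Nat.eq_of_mul_eq_mul_left hp.pos h]
  obtain ⟨T, hT, hTT⟩ := exists_index_eq_prime_commutator_self_eq_bot hQ hQ'
    (commutator_quotient_le_center le_rfl)
  refine ⟨T.comap (QuotientGroup.mk' Γ), by rw [T.index_comap_of_surjective hsurj, hT], ?_⟩
  have hmap : ⁅T.comap (QuotientGroup.mk' Γ), T.comap (QuotientGroup.mk' Γ)⁆.map
      (QuotientGroup.mk' Γ) = ⊥ := by
    rw [Subgroup.map_commutator, Subgroup.map_comap_eq_self_of_surjective hsurj, hTT]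
  rwa [Subgroup.map_eq_bot_iff, QuotientGroup.ker_mk'] at hmap

theorem sq_mem_cod_of_card_eq_pow_six (hcard : Nat.card G = p ^ 6)
    (hexp : ∀ x : G, x ^ p ∈ commutator G) (hne : (⁅commutator G, ⊤⁆ : Subgroup G) ≠ ⊥) :
    (p : ℂ) ^ 2 ∈ cod G := by
  have hp : p.Prime := Fact.out
  have hG := IsPGroup.of_card hcard
  have hle : ⁅commutator G, ⊤⁆ ≤ commutator G := Subgroup.commutator_le_left _ _
  have hne' : commutator G ≠ ⊥ := fun h => hne (le_bot_iff.1 (hle.trans h.le))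
  have hnil := hG.isNilpotent
  obtain ⟨k, hk⟩ := IsPGroup.iff_card.1 (hG.to_subgroup (commutator G))
  obtain ⟨m, hm⟩ := IsPGroup.iff_card.1 (hG.to_subgroup ⁅commutator G, ⊤⁆)
  have hm0 : m ≠ 0 := fun h => hne (Subgroup.card_eq_one.1 (by rw [hm, h, pow_zero]))
  have hmul := card_mul_relIndex hle
  obtain ⟨r, hr⟩ := (hG.to_subgroup (commutator G)).index
    ((⁅commutator G, ⊤⁆ : Subgroup G).subgroupOf (commutator G))
  rw [← Subgroup.relIndex] at hr
  rw [hm, hr, hk, ← pow_add, Nat.pow_right_inj hp.two_le] at hmul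
  have hr0 : r ≠ 0 := fun h => (commutator_top_lt hne').not_ge
    (Subgroup.relIndex_eq_one.1 (by rw [hr, h, pow_zero]))
  rcases eq_or_ne r 1 with rfl | hr1
  · exact sq_mem_cod_of_relIndex_eq_prime hG hexp hne (by rw [hr, pow_one])
  rcases le_or_gt 4 k with hk4 | hk4
  · refine sq_mem_cod_of_index_commutator_dvd_sq hG hne'
      (Nat.dvd_of_mul_dvd_mul_left (pow_pos hp.pos 4) ?_)
    rw [← pow_add, ← hcard, ← Subgroup.card_mul_index (commutator G), hk]
    exact mul_dvd_mul_right (pow_dvd_pow p hk4) _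
  · obtain ⟨rfl, rfl⟩ : k = 3 ∧ m = 1 := by omega
    rw [pow_one] at hm
    obtain ⟨U, hU, hUU⟩ := exists_index_eq_prime_commutator_self_le hcard hk hm
    by_cases hUc : U ≤ Subgroup.centralizer (commutator G)
    · exact sq_mem_cod_of_le_centralizer_commutator hG hexp hm hU hUc
    · exact sq_mem_cod_of_not_le_centralizer_commutator hG hexp hm hU hUU hUc

end OrderPowSix

end Codegree

theorem mainTheorem4 {G : Type*} [Group G] [Finite G] (p : ℕ) (hp : p.Prime)
    (hcard : Nat.card G = p ^ 6) (hclass : 3 ≤ Group.nilpotencyClass G) :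
    (p : ℂ) ^ 2 ∈ Codegree.cod G := by
  have := Fact.mk hp
  have hG := IsPGroup.of_card hcard
  by_cases hexp : p ^ 2 ∣ Monoid.exponent (Abelianization G)
  · exact_mod_cast Codegree.natCast_mem_cod_of_dvd_exponent hexp
  · have hnil := hG.isNilpotent
    refine Codegree.sq_mem_cod_of_card_eq_pow_six hcard
      (Codegree.pow_mem_commutator_of_not_dvd_exponent hG hexp) fun h => ?_
    have h2 : (⊤ : Subgroup G).lowerCentralSeries 2 = ⊥ := h
    rw [Subgroup.lowerCentralSeries_eq_bot_iff_nilpotencyClass_le] at h2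
    omega
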